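/- Let $E$ be an infinite-dimensional separable real Hilbert space. For an orthonormal basis $\mathcal E=\{e_j\}_{j\in\mathbb N}$ of $E$ let $\mathcal K_{\mathcal E}$ be the collection of measurable rectangles $$\Pi=\{x\in E:\ (x,e_j)\in[a_j,b_j)\ \ \forall j\in\mathbb N\},\qquad a,b\in\ell_\infty,$$ where measurable means that $\Pi=\varnothing$ or $\sum_{j}\max\{0,\ln(b_j-a_j)\}<\infty$. Put $\lambda_{\mathcal E}(\varnothing)=0$ and $\lambda_{\mathcal E}(\Pi)=\exp\bigl[\sum_j\ln(b_j-a_j)\bigr]\in[0,\infty)$ for nonempty $\Pi\in\mathcal K_{\mathcal E}$, with $\exp(-\infty)=0$. Let $r_{\mathcal E}$ be the ring of subsets of $E$ generated by $\mathcal K_{\mathcal E}$. The function $\lambda_{\mathcal E}$ has a unique finitely additive nonnegative extension to $r_{\mathcal E}$, again denoted $\lambda_{\mathcal E}$. For $A\subset E$ let $$\overline{\lambda_{\mathcal E}}(A)=\inf\{\lambda_{\mathcal E}(C):\ C\in r_{\mathcal E},\ C\supset A\}\in[0,\infty]\qquad(\inf\varnothing=+\infty)$$ be the outer measure. Let $\mathcal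 R_{\mathcal E}$ be the collection of all $A\subset E$ such that for every $\varepsilon>0$ there are $B,C\in r_{\mathcal E}$ with $B\subset A\subset C$ and $\lambda_{\mathcal E}(C\setminus B)<\varepsilon$; for $A\in\mathcal R_{\mathcal E}$ put $\lambda_{\mathcal E}(A)=\overline{\lambda_{\mathcal E}}(A)$. **Theorem 5.1.** Let $\mathcal E=\{e_j\}$ and $\mathcal F=\{f_j\}$ be orthonormal bases of $E$ for which the nearness condition $$\prod_{j=1}^\infty\ \sum_{i=1}^\infty|(e_i,f_j)|<+\infty$$ fails. Then 1. $\lambda_{\mathcal E}(A)=\lambda_{\mathcal F}(A)=0$ for every $A\in\mathcal R_{\mathcal E}\cap\mathcal R_{\mathcal F}$; 2. $\overline{\lambda_{\mathcal F}}(P)=+\infty$ for every $P\in\mathcal K_{\mathcal E}$ with $\lambda_{\mathcal E}(P)>0$, and $\overline{\lambda_{\mathcal E}}(Q)=+\infty$ for every $Q\in\mathcal K_{\mathcal F}$ with $\lambda_{\mathcal F}(Q)>0$. -/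

import Mathlib

namespace RectMeasure

open MeasureTheory Filter Topology
open scoped ENNReal

noncomputable section

variable {E : Type*} [NormedAddCommGroup E] [InnerProductSpace ℝ E]

/-! ### Rectangles and their volumes -/

/-- The set of all `x` whose `j`-th coordinate in the basis `e` lies in `[a j, b j)` for all `j`. -/
def rect (e : HilbertBasis ℕ ℝ E) (a b : ℕ → ℝ) : Set E :=
  {x | ∀ j, inner ℝ x (e j) ∈ Set.Ico (a j) (b j)}

/-- `a` and `b` define a measurable rectangle: both are bounded sequences, and the rectangle is
empty or `∑ max {0, log (b j - a j)} < ∞`. -/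
structure IsMeasurableRect (e : HilbertBasis ℕ ℝ E) (a b : ℕ → ℝ) : Prop where
  bdd_left : Memℓp a ∞
  bdd_right : Memℓp b ∞
  empty_or_summable : rect e a b = ∅ ∨ Summable fun j => max 0 (Real.log (b j - a j))

/-- The collection of measurable rectangles with edges along the vectors of `e`. -/
def rectangles (e : HilbertBasis ℕ ℝ E) : Set (Set E) :=
  {P | ∃ a b, IsMeasurableRect e a b ∧ P = rect e a b}

/-- `exp (∑ log (b j - a j))`, the volume of a nonempty measurable rectangle. The positive parts
of the terms of that series are summable, so that the series either converges absolutely or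
diverges to `-∞`; in the second case the value is `exp (-∞) = 0`. -/
def rectVolume (a b : ℕ → ℝ) : ℝ :=
  open scoped Classical in
  if Summable fun j => Real.log (b j - a j) then Real.exp (∑' j, Real.log (b j - a j)) else 0

/-- The ring of subsets of `E` generated by the measurable rectangles along `e`. -/
def rectRing (e : HilbertBasis ℕ ℝ E) : Set (Set E) :=
  ⋂₀ {R | IsSetRing R ∧ rectangles e ⊆ R}

/-- `m` is, on the ring generated by the rectangles, a finitely additive nonnegative set function
that extends the volume of rectangles. -/
structure IsRectExtension (e : HilbertBasis ℕ ℝ E) (m : Set E → ℝ) : Prop where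
  nonneg : ∀ A ∈ rectRing e, 0 ≤ m A
  additive : ∀ A ∈ rectRing e, ∀ B ∈ rectRing e, Disjoint A B → m (A ∪ B) = m A + m B
  rect_eq : ∀ a b, IsMeasurableRect e a b → (rect e a b).Nonempty →
    m (rect e a b) = rectVolume a b

theorem isSetRing_rectRing (e : HilbertBasis ℕ ℝ E) : IsSetRing (rectRing e) where
  empty_mem := fun _ hR => hR.1.empty_mem
  union_mem := fun _ _ hs ht R hR => hR.1.union_mem (hs R hR) (ht R hR)
  sdiff_mem := fun _ _ hs ht R hR => hR.1.sdiff_mem (hs R hR) (ht R hR)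

theorem rectangles_subset_rectRing (e : HilbertBasis ℕ ℝ E) : rectangles e ⊆ rectRing e :=
  fun _ hP _ hR => hR.2 hP

/-! ### Uniqueness of the extension -/

theorem inter_mem_rectangles (e : HilbertBasis ℕ ℝ E) {P Q : Set E}
    (hP : P ∈ rectangles e) (hQ : Q ∈ rectangles e) : P ∩ Q ∈ rectangles e := by
  obtain ⟨a, b, h, rfl⟩ := hP
  obtain ⟨a', b', h', rfl⟩ := hQ
  have hbd : ∀ {u v w : ℕ → ℝ}, Memℓp u ∞ → Memℓp v ∞ →
      (∀ j, |w j| ≤ max |u j| |v j|) → Memℓp w ∞ := by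
    intro u v w hu hv hw
    rw [memℓp_infty_iff] at *
    obtain ⟨C, hC⟩ := hu
    obtain ⟨D, hD⟩ := hv
    refine ⟨max C D, ?_⟩
    rintro _ ⟨j, rfl⟩
    exact (hw j).trans (max_le_max (hC ⟨j, rfl⟩) (hD ⟨j, rfl⟩))
  have heq : rect e a b ∩ rect e a' b'
      = rect e (fun j => max (a j) (a' j)) (fun j => min (b j) (b' j)) := by
    ext x
    simp only [rect, Set.mem_inter_iff, Set.mem_ofPred_eq, Set.mem_Ico, max_le_iff, lt_min_iff]
    grind
  refine ⟨_, _, ⟨hbd h.bdd_left h'.bdd_left fun j => abs_max_le_max_abs_abs,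
    hbd h.bdd_right h'.bdd_right fun j => abs_min_le_max_abs_abs, ?_⟩, heq⟩
  rw [← heq]
  rcases Set.eq_empty_or_nonempty (rect e a b ∩ rect e a' b') with h0 | ⟨x, hx⟩
  · exact Or.inl h0
  · right
    rcases h.empty_or_summable with h1 | h1
    · rw [h1] at hx; exact hx.1.elim
    · refine Summable.of_nonneg_of_le (fun j => le_max_left _ _) (fun j => ?_) h1
      have hx' := heq ▸ hx
      have := hx' j
      refine max_le_max le_rfl (Real.log_le_log ?_ ?_)
      · have := this.1.trans_lt this.2; linarith
      · have h2 := min_le_left (b j) (b' j)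
        have h3 := le_max_left (a j) (a' j)
        linarith

/-- Two finitely additive extensions agree on the ring generated by the rectangles. -/
theorem IsRectExtension.unique {e : HilbertBasis ℕ ℝ E} {m₁ m₂ : Set E → ℝ}
    (h₁ : IsRectExtension e m₁) (h₂ : IsRectExtension e m₂) :
    ∀ A ∈ rectRing e, m₁ A = m₂ A := by
  have hr := isSetRing_rectRing e
  have hempty : ∀ {m}, IsRectExtension e m → m ∅ = 0 := by
    intro m hm
    have := hm.additive ∅ hr.empty_mem ∅ hr.empty_mem (by simp)
    simp at this; exact this
  -- families stable under disjoint unions and proper differences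
  let Dyn : Set (Set E) → Prop := fun D =>
    (∀ A ∈ D, ∀ B ∈ D, Disjoint A B → A ∪ B ∈ D) ∧ (∀ A ∈ D, ∀ B ∈ D, B ⊆ A → A \ B ∈ D)
  let δ : Set (Set E) := ⋂₀ {D | Dyn D ∧ rectangles e ⊆ D}
  have hδ : Dyn δ := ⟨fun A hA B hB hd D hD => hD.1.1 A (hA D hD) B (hB D hD) hd,
    fun A hA B hB hd D hD => hD.1.2 A (hA D hD) B (hB D hD) hd⟩
  have hKδ : rectangles e ⊆ δ := fun P hP D hD => hD.2 hP
  have hstable : ∀ B, Dyn {A | A ∩ B ∈ δ} := by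
    intro B
    refine ⟨fun A hA A' hA' hd => ?_, fun A hA A' hA' hs => ?_⟩
    · change (A ∪ A') ∩ B ∈ δ
      rw [Set.union_inter_distrib_right]
      exact hδ.1 _ hA _ hA' (hd.mono Set.inter_subset_left Set.inter_subset_left)
    · change (A \ A') ∩ B ∈ δ
      have : (A \ A') ∩ B = (A ∩ B) \ (A' ∩ B) := by
        ext x; simp only [Set.mem_inter_iff, Set.mem_sdiff]; tauto
      rw [this]
      exact hδ.2 _ hA _ hA' (Set.inter_subset_inter_left _ hs)
  have hi1 : ∀ A ∈ δ, ∀ B ∈ rectangles e, A ∩ B ∈ δ := fun A hA B hB =>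
    hA {A | A ∩ B ∈ δ} ⟨hstable B, fun P hP => hKδ (inter_mem_rectangles e hP hB)⟩
  have hi2 : ∀ A ∈ δ, ∀ B ∈ δ, A ∩ B ∈ δ := fun A hA B hB =>
    hA {A | A ∩ B ∈ δ} ⟨hstable B, fun P hP => by
      change P ∩ B ∈ δ
      rw [Set.inter_comm]; exact hi1 B hB P hP⟩
  have hdiff : ∀ A ∈ δ, ∀ B ∈ δ, A \ B ∈ δ := by
    intro A hA B hB
    rw [← Set.sdiff_inter_self_eq_sdiff, Set.inter_comm]
    exact hδ.2 _ hA _ (hi2 A hA B hB) Set.inter_subset_left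
  have hδring : IsSetRing δ := by
    refine ⟨?_, fun A B hA hB => ?_, fun A B hA hB => hdiff A hA B hB⟩
    · have h0 : rect e 0 0 = ∅ := by
        ext x; simp [rect]
      exact hKδ ⟨0, 0, ⟨zero_memℓp, zero_memℓp, Or.inl h0⟩, h0.symm⟩
    · rw [← Set.sdiff_union_self]
      exact hδ.1 _ (hdiff A hA B hB) _ hB Set.disjoint_sdiff_left
  intro A hA
  have hAδ : A ∈ δ := hA δ ⟨hδring, hKδ⟩
  refine (hAδ {A | A ∈ rectRing e ∧ m₁ A = m₂ A} ⟨⟨?_, ?_⟩, ?_⟩).2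
  · rintro A ⟨hA, hA'⟩ B ⟨hB, hB'⟩ hd
    exact ⟨hr.union_mem hA hB, by rw [h₁.additive A hA B hB hd, h₂.additive A hA B hB hd, hA', hB']⟩
  · rintro A ⟨hA, hA'⟩ B ⟨hB, hB'⟩ hs
    have hAB := hr.sdiff_mem hA hB
    refine ⟨hAB, ?_⟩
    have e1 := h₁.additive _ hAB B hB Set.disjoint_sdiff_left
    have e2 := h₂.additive _ hAB B hB Set.disjoint_sdiff_left
    rw [Set.sdiff_union_of_subset hs] at e1 e2
    linarith
  · rintro P hP
    refine ⟨rectangles_subset_rectRing e hP, ?_⟩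
    obtain ⟨a, b, h, rfl⟩ := hP
    rcases Set.eq_empty_or_nonempty (rect e a b) with h0 | h0
    · rw [h0, hempty h₁, hempty h₂]
    · rw [h₁.rect_eq a b h h0, h₂.rect_eq a b h h0]

/-! ### Existence of the extension, through a countably additive measure on sequences -/

/-- The box in the space of all real sequences. -/
def seqBox (a b : ℕ → ℝ) : Set (ℕ → ℝ) := Set.univ.pi fun j => Set.Ico (a j) (b j)

def boxVol (a b : ℕ → ℝ) : ℝ≥0∞ :=
  limsup (fun n => ∏ j ∈ Finset.range n, ENNReal.ofReal (b j - a j)) atTop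

def boxPre (s : Set (ℕ → ℝ)) : ℝ≥0∞ := ⨅ (a) (b) (_ : s ⊆ seqBox a b), boxVol a b

theorem boxPre_empty : boxPre ∅ = 0 := by
  refine le_antisymm (iInf_le_of_le 0 (iInf_le_of_le 0 (iInf_le_of_le (by simp) ?_))) zero_le
  have : boxVol 0 0 = limsup (fun _ : ℕ => (0 : ℝ≥0∞)) atTop := by
    refine limsup_congr ?_
    filter_upwards [eventually_ge_atTop 1] with n hn
    exact Finset.prod_eq_zero (Finset.mem_range.2 hn) (by simp)
  rw [this]; simp

def boxOuter : OuterMeasure (ℕ → ℝ) := OuterMeasure.ofFunction boxPre boxPre_empty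

theorem boxVol_eq (j : ℕ) (a b : ℕ → ℝ) :
    boxVol a b = ENNReal.ofReal (b j - a j) *
      limsup (fun n => ∏ i ∈ (Finset.range n).erase j, ENNReal.ofReal (b i - a i)) atTop := by
  rw [← ENNReal.limsup_const_mul_of_ne_top ENNReal.ofReal_ne_top]
  refine limsup_congr ?_
  filter_upwards [eventually_gt_atTop j] with n hn
  exact (Finset.mul_prod_erase _ _ (Finset.mem_range.2 hn)).symm

theorem measurableSet_half (j : ℕ) (c : ℝ) :
    MeasurableSet[boxOuter.caratheodory] {x : ℕ → ℝ | x j < c} := by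
  refine OuterMeasure.ofFunction_caratheodory fun t => ?_
  refine le_iInf fun a => le_iInf fun b => le_iInf fun h => ?_
  have h1 : boxPre (t ∩ {x | x j < c}) ≤ boxVol a (Function.update b j (min (b j) c)) := by
    refine iInf_le_of_le a (iInf_le_of_le _ (iInf_le_of_le ?_ le_rfl))
    rintro x ⟨hx, hxc⟩ i -
    have := h hx i trivial
    rcases eq_or_ne i j with rfl | hi
    · simp only [Function.update_self]
      exact ⟨this.1, lt_min this.2 hxc⟩
    · simpa only [Function.update_of_ne hi] using this
  have h2 : boxPre (t \ {x | x j < c}) ≤ boxVol (Function.update a j (max (a j) c)) b := by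
    refine iInf_le_of_le _ (iInf_le_of_le b (iInf_le_of_le ?_ le_rfl))
    rintro x ⟨hx, hxc⟩ i -
    have := h hx i trivial
    rcases eq_or_ne i j with rfl | hi
    · simp only [Function.update_self]
      exact ⟨max_le this.1 (not_lt.1 hxc), this.2⟩
    · simpa only [Function.update_of_ne hi] using this
  refine (add_le_add h1 h2).trans ?_
  have e1 : ∀ n, ∏ i ∈ (Finset.range n).erase j,
      ENNReal.ofReal (Function.update b j (min (b j) c) i - a i)
      = ∏ i ∈ (Finset.range n).erase j, ENNReal.ofReal (b i - a i) := fun n =>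
    Finset.prod_congr rfl fun i hi => by
      rw [Function.update_of_ne (Finset.ne_of_mem_erase hi)]
  have e2 : ∀ n, ∏ i ∈ (Finset.range n).erase j,
      ENNReal.ofReal (b i - Function.update a j (max (a j) c) i)
      = ∏ i ∈ (Finset.range n).erase j, ENNReal.ofReal (b i - a i) := fun n =>
    Finset.prod_congr rfl fun i hi => by
      rw [Function.update_of_ne (Finset.ne_of_mem_erase hi)]
  rw [boxVol_eq j, boxVol_eq j _ b, boxVol_eq j a b]
  simp only [e1, e2, Function.update_self]
  rw [← add_mul]
  refine mul_le_mul_left ?_ _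
  rcases le_total (b j) (a j) with hab | hab
  · have t1 := min_le_left (b j) c
    have t2 := le_max_left (a j) c
    rw [ENNReal.ofReal_of_nonpos (by linarith), ENNReal.ofReal_of_nonpos (by linarith)]
    simp
  · rcases le_total c (a j) with hc | hc
    · rw [min_eq_right (hc.trans hab), max_eq_left hc, ENNReal.ofReal_of_nonpos (by linarith),
        zero_add]
    · rw [max_eq_right hc]
      rcases le_total c (b j) with hcb | hcb
      · rw [min_eq_right hcb, ← ENNReal.ofReal_add (by linarith) (by linarith)]
        exact ENNReal.ofReal_le_ofReal (by linarith)
      · rw [min_eq_left hcb, ENNReal.ofReal_of_nonpos (p := b j - c) (by linarith), add_zero]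

theorem pi_le_caratheodory :
    (MeasurableSpace.pi : MeasurableSpace (ℕ → ℝ)) ≤ boxOuter.caratheodory := by
  refine iSup_le fun j => ?_
  rw [BorelSpace.measurable_eq (α := ℝ), borel_eq_generateFrom_Iio,
    MeasurableSpace.comap_generateFrom]
  refine MeasurableSpace.generateFrom_le ?_
  rintro _ ⟨_, ⟨c, rfl⟩, rfl⟩
  exact measurableSet_half j c

/-- A countably additive measure on the space of all real sequences. -/
def seqMeasure : Measure (ℕ → ℝ) := boxOuter.toMeasure pi_le_caratheodory

theorem measurableSet_seqBox (a b : ℕ → ℝ) : MeasurableSet (seqBox a b) :=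
  MeasurableSet.univ_pi fun _ => measurableSet_Ico

theorem seqMeasure_seqBox {a b : ℕ → ℝ} (hab : ∀ j, a j < b j) :
    seqMeasure (seqBox a b) = boxVol a b := by
  rw [seqMeasure, toMeasure_apply _ _ (measurableSet_seqBox a b)]
  refine le_antisymm ((OuterMeasure.ofFunction_le _).trans
    (iInf_le_of_le a (iInf_le_of_le b (iInf_le_of_le le_rfl le_rfl)))) ?_
  let P : ℕ → Measure ℝ := fun j => ProbabilityTheory.cond volume (Set.Ico (a j) (b j))
  have hv : ∀ j, volume (Set.Ico (a j) (b j)) = ENNReal.ofReal (b j - a j) := fun j =>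
    Real.volume_Ico
  have hpos : ∀ j, ENNReal.ofReal (b j - a j) ≠ 0 := fun j => by
    have := hab j
    simp only [ne_eq, ENNReal.ofReal_eq_zero, not_le]; linarith
  have hP : ∀ j, IsProbabilityMeasure (P j) := fun j =>
    ProbabilityTheory.cond_isProbabilityMeasure_of_finite (by rw [hv]; exact hpos j)
      (by rw [hv]; exact ENNReal.ofReal_ne_top)
  have hself : Measure.infinitePi P (seqBox a b) = 1 := by
    rw [seqBox, Measure.infinitePi_pi_univ _ fun _ => measurableSet_Ico]
    have : ∀ j, P j (Set.Ico (a j) (b j)) = 1 := fun j =>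
      ProbabilityTheory.cond_apply_self (by rw [hv]; exact hpos j)
        (by rw [hv]; exact ENNReal.ofReal_ne_top)
    simp [this]
  have key : boxVol a b • (Measure.infinitePi P).toOuterMeasure ≤ boxOuter := by
    refine OuterMeasure.le_ofFunction.2 fun s => ?_
    refine le_iInf fun a' => le_iInf fun b' => le_iInf fun hs => ?_
    change boxVol a b * Measure.infinitePi P s ≤ boxVol a' b'
    rcases eq_or_ne (Measure.infinitePi P s) ⊤ with htop | htop
    · exact absurd htop (measure_ne_top _ _)
    rw [mul_comm, boxVol, ← ENNReal.limsup_const_mul_of_ne_top htop]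
    refine limsup_le_limsup (Eventually.of_forall fun n => ?_)
    have h1 : Measure.infinitePi P s
        ≤ ∏ j ∈ Finset.range n, P j (Set.Ico (a' j) (b' j)) := by
      rw [← Measure.infinitePi_pi P fun _ _ => measurableSet_Ico]
      exact measure_mono (hs.trans (Set.pi_mono' (fun _ _ => le_rfl) (Set.subset_univ _)))
    refine (mul_le_mul_left h1 _).trans ?_
    rw [← Finset.prod_mul_distrib]
    refine Finset.prod_le_prod' fun j _ => ?_
    rw [ProbabilityTheory.cond_apply measurableSet_Ico, hv, mul_right_comm,
      ENNReal.inv_mul_cancel (hpos j) ENNReal.ofReal_ne_top, one_mul, ← Real.volume_Ico]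
    exact measure_mono Set.inter_subset_right
  have := key (seqBox a b)
  change boxVol a b * Measure.infinitePi P (seqBox a b) ≤ _ at this
  rwa [hself, mul_one] at this

theorem boxVol_eq_rectVolume {a b : ℕ → ℝ} (hab : ∀ j, a j < b j)
    (hs : Summable fun j => max 0 (Real.log (b j - a j))) :
    boxVol a b = ENNReal.ofReal (rectVolume a b) := by
  have hprod : ∀ n, ∏ j ∈ Finset.range n, ENNReal.ofReal (b j - a j)
      = ENNReal.ofReal (Real.exp (∑ j ∈ Finset.range n, Real.log (b j - a j))) := by
    intro n
    rw [Real.exp_sum, ENNReal.ofReal_prod_of_nonneg fun _ _ => (Real.exp_pos _).le]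
    refine Finset.prod_congr rfl fun j _ => ?_
    rw [Real.exp_log (by linarith [hab j])]
  have key : Tendsto (fun n => Real.exp (∑ j ∈ Finset.range n, Real.log (b j - a j))) atTop
      (𝓝 (rectVolume a b)) := by
    unfold rectVolume
    split_ifs with h
    · exact (Real.continuous_exp.tendsto _).comp h.hasSum.tendsto_sum_nat
    · refine Real.tendsto_exp_atBot.comp ?_
      have hneg : ¬ Summable fun j => max 0 (-Real.log (b j - a j)) := by
        intro h'
        apply h
        refine (hs.sub h').congr fun j => ?_
        rcases le_total 0 (Real.log (b j - a j)) with h0 | h0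
        · rw [max_eq_right h0, max_eq_left (by linarith)]; ring
        · rw [max_eq_left h0, max_eq_right (by linarith)]; ring
      have h1 := (not_summable_iff_tendsto_nat_atTop_of_nonneg
        (fun j => le_max_left 0 (-Real.log (b j - a j)))).1 hneg
      have h2 := hs.hasSum.tendsto_sum_nat.add_atBot (tendsto_neg_atTop_atBot.comp h1)
      refine h2.congr fun n => ?_
      simp only [Function.comp_apply]
      rw [← Finset.sum_neg_distrib, ← Finset.sum_add_distrib]
      refine Finset.sum_congr rfl fun j _ => ?_
      rcases le_total 0 (Real.log (b j - a j)) with h0 | h0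
      · rw [max_eq_right h0, max_eq_left (by linarith)]; ring
      · rw [max_eq_left h0, max_eq_right (by linarith)]; ring
  rw [boxVol]
  simp_rw [hprod]
  exact ((ENNReal.continuous_ofReal.tendsto _).comp key).limsup_eq

theorem rectVolume_nonneg (a b : ℕ → ℝ) : 0 ≤ rectVolume a b := by
  unfold rectVolume
  split_ifs
  · positivity
  · exact le_rfl

/-- Replace the coordinates of `x` from `M` on by their truncations to `[-t j, t j]`. -/
def truncTail (x t : ℕ → ℝ) (M : ℕ) : ℕ → ℝ :=
  fun j => if j < M then x j else max (-t j) (min (x j) (t j))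

/-- Membership in `S` does not change under truncation of far coordinates. -/
def IsTruncStable (S : Set (ℕ → ℝ)) : Prop :=
  ∃ s : ℕ → ℝ, (∀ j, 0 ≤ s j) ∧ (Memℓp s 2) ∧
    ∀ x t : ℕ → ℝ, (∀ j, s j ≤ t j) → ∀ᶠ M in atTop, (truncTail x t M ∈ S ↔ x ∈ S)

def seqRing : Set (Set (ℕ → ℝ)) :=
  {S | IsTruncStable S ∧ MeasurableSet S ∧ seqMeasure S ≠ ⊤}

theorem isSetRing_seqRing : IsSetRing seqRing where
  empty_mem := ⟨⟨0, fun _ => le_rfl, zero_memℓp, by simp⟩, MeasurableSet.empty, by simp⟩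
  union_mem := by
    rintro S T ⟨⟨s, hs0, hs, h⟩, hSm, hSf⟩ ⟨⟨s', hs0', hs', h'⟩, hTm, hTf⟩
    refine ⟨⟨s + s', fun j => add_nonneg (hs0 j) (hs0' j), hs.add hs', fun x t ht => ?_⟩,
      hSm.union hTm, measure_union_ne_top hSf hTf⟩
    filter_upwards [h x t fun j => (le_add_of_nonneg_right (hs0' j)).trans (ht j),
      h' x t fun j => (le_add_of_nonneg_left (hs0 j)).trans (ht j)] with M h1 h2
    simp only [Set.mem_union, h1, h2]
  sdiff_mem := by
    rintro S T ⟨⟨s, hs0, hs, h⟩, hSm, hSf⟩ ⟨⟨s', hs0', hs', h'⟩, hTm, hTf⟩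
    refine ⟨⟨s + s', fun j => add_nonneg (hs0 j) (hs0' j), hs.add hs', fun x t ht => ?_⟩,
      hSm.diff hTm, measure_ne_top_of_subset Set.sdiff_subset hSf⟩
    filter_upwards [h x t fun j => (le_add_of_nonneg_right (hs0' j)).trans (ht j),
      h' x t fun j => (le_add_of_nonneg_left (hs0 j)).trans (ht j)] with M h1 h2
    simp only [Set.mem_sdiff, h1, h2]

def coords (e : HilbertBasis ℕ ℝ E) (x : E) : ℕ → ℝ := fun j => inner ℝ x (e j)

theorem memℓp_coords (e : HilbertBasis ℕ ℝ E) (x : E) : Memℓp (coords e x) 2 := by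
  have : coords e x = fun j => e.repr x j := by
    ext j
    rw [e.repr_apply_apply, real_inner_comm]; rfl
  rw [this]
  exact lp.memℓp _

theorem exists_coords (e : HilbertBasis ℕ ℝ E) {y : ℕ → ℝ} (hy : Memℓp y 2) :
    ∃ x, coords e x = y := by
  let z : lp (fun _ : ℕ => ℝ) 2 := ⟨y, hy⟩
  refine ⟨e.repr.symm z, ?_⟩
  ext j
  have := e.repr_apply_apply (e.repr.symm z) j
  rw [LinearIsometryEquiv.apply_symm_apply] at this
  rw [coords, real_inner_comm, ← this]

theorem eq_empty_of_preimage (e : HilbertBasis ℕ ℝ E) {S : Set (ℕ → ℝ)} (hS : S ∈ seqRing)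
    (h : coords e ⁻¹' S = ∅) : S = ∅ := by
  by_contra hne
  obtain ⟨x, hx⟩ := Set.nonempty_iff_ne_empty.2 hne
  obtain ⟨⟨s, hs0, hs, hst⟩, -⟩ := hS
  obtain ⟨M, hM⟩ := (hst x s fun _ => le_rfl).exists
  have hmem : Memℓp (truncTail x s M) 2 := by
    have h1 : Memℓp (fun j => if j < M then |x j| else 0) 2 := by
      refine (memℓp_zero ?_).of_exponent_ge zero_le
      refine (Set.finite_Iio M).subset fun j hj => ?_
      by_contra hj'
      exact hj (if_neg hj')
    refine (h1.add hs).mono fun j => ?_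
    have := hs0 j
    simp only [truncTail, Pi.add_apply, Real.norm_eq_abs]
    split_ifs
    · linarith
    · rw [zero_add, abs_le]
      exact ⟨le_max_left _ _, max_le (by linarith) (min_le_right _ _)⟩
  obtain ⟨y, hy⟩ := exists_coords e hmem
  have : y ∈ coords e ⁻¹' S := by
    change coords e y ∈ S
    rw [hy]; exact hM.2 hx
  rw [h] at this
  exact this

theorem eq_of_preimage (e : HilbertBasis ℕ ℝ E) {S T : Set (ℕ → ℝ)} (hS : S ∈ seqRing)
    (hT : T ∈ seqRing) (h : coords e ⁻¹' S = coords e ⁻¹' T) : S = T := by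
  have h1 := eq_empty_of_preimage e (isSetRing_seqRing.sdiff_mem hS hT)
    (by rw [Set.preimage_sdiff, h, Set.sdiff_self])
  have h2 := eq_empty_of_preimage e (isSetRing_seqRing.sdiff_mem hT hS)
    (by rw [Set.preimage_sdiff, h, Set.sdiff_self])
  exact Set.Subset.antisymm (Set.sdiff_eq_empty.1 h1) (Set.sdiff_eq_empty.1 h2)

theorem seqBox_mem_seqRing {e : HilbertBasis ℕ ℝ E} {a b : ℕ → ℝ} (h : IsMeasurableRect e a b)
    (hne : (rect e a b).Nonempty) :
    seqBox a b ∈ seqRing ∧ seqMeasure (seqBox a b) = ENNReal.ofReal (rectVolume a b) := by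
  obtain ⟨y, hy⟩ := hne
  have hab : ∀ j, a j < b j := fun j => (hy j).1.trans_lt (hy j).2
  have hs : Summable fun j => max 0 (Real.log (b j - a j)) := by
    rcases h.empty_or_summable with h1 | h1
    · rw [h1] at hy; exact hy.elim
    · exact h1
  have hv := (seqMeasure_seqBox hab).trans (boxVol_eq_rectVolume hab hs)
  refine ⟨⟨⟨fun j => |coords e y j|, fun j => abs_nonneg _, (memℓp_coords e y).norm, ?_⟩,
    measurableSet_seqBox a b, by rw [hv]; exact ENNReal.ofReal_ne_top⟩, hv⟩
  intro x t ht
  by_cases hx : x ∈ seqBox a b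
  · refine Eventually.of_forall fun M => iff_of_true (fun j _ => ?_) hx
    have h1 := hx j trivial
    have h2 := hy j
    have h3 := abs_le.1 (ht j)
    simp only [coords] at h3
    simp only [truncTail]
    split_ifs
    · exact h1
    · have h4 := le_min h1.1 (h2.1.trans h3.2)
      exact ⟨h4.trans (le_max_right _ _),
        max_lt (h3.1.trans_lt h2.2) ((min_le_left _ _).trans_lt h1.2)⟩
  · obtain ⟨j, hj⟩ : ∃ j, x j ∉ Set.Ico (a j) (b j) := by
      by_contra hcon
      push Not at hcon
      exact hx fun j _ => hcon j
    filter_upwards [eventually_gt_atTop j] with M hM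
    refine iff_of_false (fun hmem => hj ?_) hx
    have := hmem j trivial
    simpa only [truncTail, if_pos hM] using this

theorem exists_seqRing (e : HilbertBasis ℕ ℝ E) {A : Set E} (hA : A ∈ rectRing e) :
    ∃ S ∈ seqRing, coords e ⁻¹' S = A := by
  refine hA {A | ∃ S ∈ seqRing, coords e ⁻¹' S = A} ⟨⟨?_, ?_, ?_⟩, ?_⟩
  · exact ⟨∅, isSetRing_seqRing.empty_mem, rfl⟩
  · rintro _ _ ⟨S, hS, rfl⟩ ⟨T, hT, rfl⟩
    exact ⟨_, isSetRing_seqRing.union_mem hS hT, rfl⟩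
  · rintro _ _ ⟨S, hS, rfl⟩ ⟨T, hT, rfl⟩
    exact ⟨_, isSetRing_seqRing.sdiff_mem hS hT, rfl⟩
  · rintro _ ⟨a, b, h, rfl⟩
    rcases Set.eq_empty_or_nonempty (rect e a b) with h0 | h0
    · exact ⟨∅, isSetRing_seqRing.empty_mem, by rw [h0]; rfl⟩
    · refine ⟨_, (seqBox_mem_seqRing h h0).1, ?_⟩
      ext x
      simp [seqBox, rect, coords]

/-- The volume of rectangles has a finitely additive extension to the ring they generate. -/
theorem exists_isRectExtension (e : HilbertBasis ℕ ℝ E) : ∃ m, IsRectExtension e m := by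
  classical
  let m : Set E → ℝ := fun A =>
    if h : ∃ S ∈ seqRing, coords e ⁻¹' S = A then (seqMeasure h.choose).toReal else 0
  have hm : ∀ S ∈ seqRing, m (coords e ⁻¹' S) = (seqMeasure S).toReal := by
    intro S hS
    have h : ∃ T ∈ seqRing, coords e ⁻¹' T = coords e ⁻¹' S := ⟨S, hS, rfl⟩
    simp only [m, dif_pos h]
    rw [eq_of_preimage e h.choose_spec.1 hS h.choose_spec.2]
  refine ⟨m, fun A hA => ?_, fun A hA B hB hd => ?_, fun a b h h0 => ?_⟩
  · obtain ⟨S, hS, rfl⟩ := exists_seqRing e hA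
    rw [hm S hS]; exact ENNReal.toReal_nonneg
  · obtain ⟨S, hS, rfl⟩ := exists_seqRing e hA
    obtain ⟨T, hT, rfl⟩ := exists_seqRing e hB
    have hST : Disjoint S T := by
      rw [Set.disjoint_iff_inter_eq_empty] at hd ⊢
      exact eq_empty_of_preimage e (isSetRing_seqRing.inter_mem hS hT) hd
    rw [← Set.preimage_union, hm _ (isSetRing_seqRing.union_mem hS hT), hm S hS, hm T hT,
      measure_union hST hT.2.1, ENNReal.toReal_add hS.2.2 hT.2.2]
  · obtain ⟨h1, h2⟩ := seqBox_mem_seqRing h h0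
    have h3 : rect e a b = coords e ⁻¹' seqBox a b := by
      ext x
      simp [seqBox, rect, coords]
    rw [h3, hm _ h1, h2, ENNReal.toReal_ofReal (rectVolume_nonneg a b)]

/-! ### The measures and the comparison of two bases -/

/-- The finitely additive extension of the volume of rectangles to the ring they generate
(it exists by `exists_isRectExtension` and is unique by `IsRectExtension.unique`). -/
def ringMeasure (e : HilbertBasis ℕ ℝ E) : Set E → ℝ := (exists_isRectExtension e).choose

theorem isRectExtension_ringMeasure (e : HilbertBasis ℕ ℝ E) :
    IsRectExtension e (ringMeasure e) := (exists_isRectExtension e).choose_spec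

/-- The ring of measurable sets: those enclosed, for every `ε > 0`, between two sets of the ring
generated by the rectangles whose difference has measure less than `ε`. -/
def measurableRing (e : HilbertBasis ℕ ℝ E) : Set (Set E) :=
  {A | ∀ ε : ℝ, 0 < ε → ∃ B ∈ rectRing e, ∃ C ∈ rectRing e,
    B ⊆ A ∧ A ⊆ C ∧ ringMeasure e (C \ B) < ε}

/-- The outer measure `inf {ringMeasure e C : C ∈ rectRing e, A ⊆ C}`, with value `∞` if there is
no such `C`. -/
def outerMeasure (e : HilbertBasis ℕ ℝ E) (A : Set E) : ℝ≥0∞ :=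
  ⨅ C ∈ {C | C ∈ rectRing e ∧ A ⊆ C}, ENNReal.ofReal (ringMeasure e C)

/-- The measure of `A ∈ measurableRing e`: the infimum of `ringMeasure e C` over all
`C ∈ rectRing e` that contain `A`. -/
def measure (e : HilbertBasis ℕ ℝ E) (A : Set E) : ℝ :=
  sInf (ringMeasure e '' {C | C ∈ rectRing e ∧ A ⊆ C})

/-- `e` is near to `f`: the product over `j` of the `ℓ¹`-norms of the columns of the transition
matrix `c i j = ⟪e i, f j⟫` is finite. All these norms are in `[1, ∞]`, so that the product
exists in `[1, ∞]`. -/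
def IsNear (e f : HilbertBasis ℕ ℝ E) : Prop :=
  ∏' j, ∑' i, ENNReal.ofReal |inner ℝ (e i) (f j)| < ∞

end

end RectMeasure

namespace RectMeasure

open MeasureTheory Filter Topology
open scoped ENNReal

variable {E : Type*} [NormedAddCommGroup E] [InnerProductSpace ℝ E]

/-! ### Summability of the transition matrix and nearness -/

/-! Write `c i j = |⟪e i, f j⟫|`. Rows and columns of `c` are unit vectors of `ℓ²`, so each column
has `ℓ¹`-norm `1 + ∑ i, c i j * (1 - c i j)`, and summability of the matrix `c (1 - c)` makes the
product of these norms converge. Failure of nearness therefore gives failure of `IsSummablyNear`, a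
condition symmetric in the two bases. Everything reduces to one claim: without it, a set of positive
measure in the ring of `e` lies in no set of the ring of `f`.

The claim rests on widths. A rectangle along `e` with edges `d i` has width `∑ i, c i j * d i` in
the direction `f j`. If it has positive volume and lies in a single rectangle along `f` whose edges
exceed `1` by a summable amount, comparing widths with edges forces `c (1 - c)` to be summable
(`isSummablyNear_of_subset`). Otherwise some point of it escapes even a slight enlargement of the
`f`-rectangle, and shrinking finitely many edges near that point leaves a rectangle of positive
volume disjoint from the `f`-rectangle (`exists_posRect_disjoint`). Repeating this rules out every
finite cover (`not_subset_sUnion`).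

General ring sets reduce to this case. From above, each lies in a finite union of rectangles. From
below, each is the trace of a countable union of boxes in sequence space, where countable additivity
yields a box of positive measure (`exists_posRect_subset`). -/

/-- The matrix `|c i j| (1 - |c i j|)`, `c i j = ⟪e i, f j⟫`, is summable. -/
def IsSummablyNear (e f : HilbertBasis ℕ ℝ E) : Prop :=
  Summable fun p : ℕ × ℕ => |inner ℝ (e p.1) (f p.2)| * (1 - |inner ℝ (e p.1) (f p.2)|)

theorem IsSummablyNear.symm {e f : HilbertBasis ℕ ℝ E} (h : IsSummablyNear e f) :
    IsSummablyNear f e := by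
  refine (h.comp_injective Prod.swap_injective).congr fun p => ?_
  simp only [Function.comp, Prod.fst_swap, Prod.snd_swap]
  rw [real_inner_comm]

theorem abs_inner_basis_le_one (e f : HilbertBasis ℕ ℝ E) (i j : ℕ) :
    |inner ℝ (e i) (f j)| ≤ 1 := by
  have := abs_real_inner_le_norm (e i) (f j)
  rwa [e.orthonormal.1, f.orthonormal.1, one_mul] at this

theorem hasSum_sq_inner_basis (e f : HilbertBasis ℕ ℝ E) (j : ℕ) :
    HasSum (fun i => inner ℝ (e i) (f j) ^ 2) 1 := by
  have := e.hasSum_inner_mul_inner (f j) (f j)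
  rw [real_inner_self_eq_norm_sq, f.orthonormal.1, one_pow] at this
  refine (funext fun i => ?_ : (fun i => inner ℝ (f j) (e i) * inner ℝ (e i) (f j))
    = fun i => inner ℝ (e i) (f j) ^ 2) ▸ this
  rw [sq, real_inner_comm (e i)]

/-- Since `c = c ^ 2 + c * (1 - c)` and the squares in a column add up to `1`, the factors of the
product are `1 + r j` with `r j ≥ 0` and `∑ r j < ∞`. -/
theorem IsSummablyNear.isNear {e f : HilbertBasis ℕ ℝ E} (h : IsSummablyNear e f) :
    IsNear e f := by
  obtain ⟨c, hc⟩ : ∃ c : ℕ → ℕ → ℝ, ∀ i j, c i j = |inner ℝ (e i) (f j)| :=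
    ⟨_, fun _ _ => rfl⟩
  have hc0 : ∀ i j, 0 ≤ c i j := fun i j => hc i j ▸ abs_nonneg _
  have hc1 : ∀ i j, c i j ≤ 1 := fun i j => hc i j ▸ abs_inner_basis_le_one e f i j
  have hsq : ∀ j, HasSum (fun i => c i j ^ 2) 1 := fun j => by
    simpa only [hc, sq_abs] using hasSum_sq_inner_basis e f j
  have hpair : Summable fun p : ℕ × ℕ => c p.2 p.1 * (1 - c p.2 p.1) := by
    simp only [hc]
    exact Summable.prod_symm h
  simp only [IsNear, ← hc]
  have h1 : ∀ j, Summable fun i => c i j * (1 - c i j) := fun j => hpair.prod_factor j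
  have h2 : Summable fun j => ∑' i, c i j * (1 - c i j) := hpair.prod
  have h3 : ∀ j, HasSum (fun i => c i j) (1 + ∑' i, c i j * (1 - c i j)) := by
    intro j
    have := (hsq j).add (h1 j).hasSum
    simp only [show ∀ i, c i j ^ 2 + c i j * (1 - c i j) = c i j from fun i => by ring] at this
    exact this
  have h0 : ∀ j, 0 ≤ ∑' i, c i j * (1 - c i j) := fun j => tsum_nonneg fun i =>
    mul_nonneg (hc0 i j) (sub_nonneg.2 (hc1 i j))
  have h4 : ∀ j, ∑' i, ENNReal.ofReal (c i j)
      = ENNReal.ofReal (1 + ∑' i, c i j * (1 - c i j)) := fun j => by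
    rw [← (h3 j).tsum_eq, ENNReal.ofReal_tsum_of_nonneg (fun i => hc0 i j) (h3 j).summable]
  obtain ⟨p, hp⟩ := Real.multipliable_one_add_of_summable h2
  have h5 : HasProd (fun j => ∑' i, ENNReal.ofReal (c i j)) (ENNReal.ofReal p) := by
    refine ((ENNReal.continuous_ofReal.tendsto p).comp hp).congr fun s => ?_
    simp only [Function.comp, h4]
    exact ENNReal.ofReal_prod_of_nonneg fun j _ => by linarith [h0 j]
  rw [h5.tprod_eq]
  exact ENNReal.ofReal_lt_top

/-! ### Boxes of positive volume -/

/-- `a` and `b` define a nonempty rectangle of positive volume. -/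
structure IsPosRect (e : HilbertBasis ℕ ℝ E) (a b : ℕ → ℝ) : Prop where
  lt : ∀ j, a j < b j
  summable : Summable fun j => |b j - a j - 1|
  nonempty : (rect e a b).Nonempty

/-- The edges tend to `1`, so their inverses form a bounded sequence. -/
theorem exists_pos_le_of_summable {d : ℕ → ℝ} (hd : ∀ j, 0 < d j)
    (hs : Summable fun j => |d j - 1|) : ∃ D, 0 < D ∧ ∀ j, D ≤ d j := by
  have h1 : Tendsto d atTop (𝓝 1) := by
    rw [tendsto_iff_norm_sub_tendsto_zero]
    exact hs.tendsto_atTop_zero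
  obtain ⟨M, hM⟩ := (h1.inv₀ one_ne_zero).bddAbove_range
  have hM' : ∀ j, (d j)⁻¹ ≤ M := fun j => hM ⟨j, rfl⟩
  have hMpos : 0 < M := (inv_pos.2 (hd 0)).trans_le (hM' 0)
  exact ⟨M⁻¹, inv_pos.2 hMpos, fun j => (inv_le_comm₀ (hd j) hMpos).1 (hM' j)⟩

/-- A vector with prescribed coordinates on a finite set, and those of `x` elsewhere. -/
theorem exists_replace (e : HilbertBasis ℕ ℝ E) (x : E) (T : Finset ℕ) (u : ℕ → ℝ) :
    ∃ y, (∀ k, inner ℝ y (e k) = if k ∈ T then u k else inner ℝ x (e k)) ∧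
      ∀ v, inner ℝ y v = inner ℝ x v + ∑ i ∈ T, (u i - inner ℝ x (e i)) * inner ℝ (e i) v := by
  have h : ∀ v, inner ℝ (x + ∑ i ∈ T, (u i - inner ℝ x (e i)) • e i) v
      = inner ℝ x v + ∑ i ∈ T, (u i - inner ℝ x (e i)) * inner ℝ (e i) v := fun v => by
    rw [inner_add_left, sum_inner]
    simp only [real_inner_smul_left]
  refine ⟨_, fun k => ?_, h⟩
  rw [h]
  simp only [orthonormal_iff_ite.1 e.orthonormal, mul_ite, mul_one, mul_zero,
    Finset.sum_ite_eq']
  split_ifs <;> ring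

/-- The width of a rectangle in the direction `v`. -/
theorem sum_abs_inner_mul_le {e : HilbertBasis ℕ ℝ E} {a b : ℕ → ℝ} (h : IsPosRect e a b) {v : E}
    {α β : ℝ} (hv : ∀ x ∈ rect e a b, inner ℝ x v ∈ Set.Icc α β) (T : Finset ℕ) :
    ∑ i ∈ T, |inner ℝ (e i) v| * (b i - a i) ≤ β - α := by
  obtain ⟨x, hx⟩ := h.nonempty
  -- The upper faces are not part of the rectangle, so the width is approached by points at the
  -- fraction `θ < 1` of each edge.
  have hlim : Tendsto (fun θ : ℝ => θ * ∑ i ∈ T, |inner ℝ (e i) v| * (b i - a i)) (𝓝[<] 1)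
      (𝓝 (∑ i ∈ T, |inner ℝ (e i) v| * (b i - a i))) := by
    have : Continuous fun θ : ℝ => θ * ∑ i ∈ T, |inner ℝ (e i) v| * (b i - a i) := by fun_prop
    simpa using (this.tendsto 1).mono_left nhdsWithin_le_nhds
  refine le_of_tendsto hlim ?_
  filter_upwards [Ioo_mem_nhdsLT (show (0 : ℝ) < 1 by norm_num)] with θ hθ
  have hmem : ∀ u : ℕ → ℝ, (∀ i, u i ∈ Set.Ico (a i) (b i)) →
      ∃ y ∈ rect e a b, inner ℝ y v
        = inner ℝ x v + ∑ i ∈ T, (u i - inner ℝ x (e i)) * inner ℝ (e i) v := by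
    intro u hu
    obtain ⟨y, hy, hyv⟩ := exists_replace e x T u
    refine ⟨y, fun k => ?_, hyv v⟩
    rw [hy]
    split_ifs
    exacts [hu k, hx k]
  have ha : ∀ i, a i ∈ Set.Ico (a i) (b i) := fun i => ⟨le_rfl, h.lt i⟩
  have hb : ∀ i, a i + θ * (b i - a i) ∈ Set.Ico (a i) (b i) := fun i => by
    have := h.lt i
    constructor <;> nlinarith [hθ.1, hθ.2]
  -- `y` and `z` sit at opposite ends of each edge in `T`, chosen by the sign of `⟪e i, v⟫`, so that
  -- every term of the difference is nonnegative.
  obtain ⟨y, hy, hyv⟩ := hmem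
    (fun i => if 0 ≤ inner ℝ (e i) v then a i + θ * (b i - a i) else a i)
    fun i => by split_ifs; exacts [hb i, ha i]
  obtain ⟨z, hz, hzv⟩ := hmem
    (fun i => if 0 ≤ inner ℝ (e i) v then a i else a i + θ * (b i - a i))
    fun i => by split_ifs; exacts [ha i, hb i]
  have hd : θ * ∑ i ∈ T, |inner ℝ (e i) v| * (b i - a i) = inner ℝ y v - inner ℝ z v := by
    rw [hyv, hzv, add_sub_add_left_eq_sub, ← Finset.sum_sub_distrib, Finset.mul_sum]
    refine Finset.sum_congr rfl fun i _ => ?_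
    split_ifs with hi
    · rw [abs_of_nonneg hi]; ring
    · rw [abs_of_neg (not_le.1 hi)]; ring
  rw [hd]
  linarith [(hv y hy).2, (hv z hz).1]

/-- The width bounds `∑ |⟪e i, v⟫| * (b i - a i)`, and the edges are bounded away from `0`. -/
theorem summable_abs_inner_of_bounded {e : HilbertBasis ℕ ℝ E} {a b : ℕ → ℝ}
    (h : IsPosRect e a b) {v : E} {α β : ℝ}
    (hv : ∀ x ∈ rect e a b, inner ℝ x v ∈ Set.Icc α β) :
    Summable fun i => |inner ℝ (e i) v| := by
  obtain ⟨D, hD, hDd⟩ := exists_pos_le_of_summable (fun j => sub_pos.2 (h.lt j)) h.summable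
  refine summable_of_sum_le (c := (β - α) / D) (fun i => abs_nonneg _) fun T => ?_
  rw [le_div_iff₀ hD, Finset.sum_mul]
  exact (Finset.sum_le_sum fun i _ => mul_le_mul_of_nonneg_left (hDd i) (abs_nonneg _)).trans
    (sum_abs_inner_mul_le h hv T)

/-- If a rectangle of positive volume along `e` lies in a rectangle along `f` whose edges have
summable excess over `1`, then the transition matrix is summably near. -/
theorem isSummablyNear_of_subset {e f : HilbertBasis ℕ ℝ E} {a b α β : ℕ → ℝ}
    (h : IsPosRect e a b) (hs : Summable fun j => max 0 (β j - α j - 1))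
    (hsub : ∀ x ∈ rect e a b, ∀ j, inner ℝ x (f j) ∈ Set.Icc (α j) (β j)) :
    IsSummablyNear e f := by
  obtain ⟨D, hD, hDd⟩ := exists_pos_le_of_summable (fun j => sub_pos.2 (h.lt j)) h.summable
  obtain ⟨c, hc⟩ : ∃ c : ℕ → ℕ → ℝ, ∀ i j, c i j = |inner ℝ (e i) (f j)| :=
    ⟨_, fun _ _ => rfl⟩
  have hc0 : ∀ i j, 0 ≤ c i j := fun i j => hc i j ▸ abs_nonneg _
  have hc1 : ∀ i j, c i j ≤ 1 := fun i j => hc i j ▸ abs_inner_basis_le_one e f i j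
  have hwidth : ∀ (j : ℕ) (T : Finset ℕ), ∑ i ∈ T, c i j * (b i - a i) ≤ β j - α j :=
    fun j T => by
      simp only [hc]
      exact sum_abs_inner_mul_le h (fun x hx => hsub x hx j) T
  have hcol : ∀ j, HasSum (fun i => c i j ^ 2) 1 := fun j => by
    simpa only [hc, sq_abs] using hasSum_sq_inner_basis e f j
  have hrow : ∀ i, HasSum (fun j => c i j ^ 2) 1 := fun i => by
    simpa only [hc, sq_abs, real_inner_comm] using hasSum_sq_inner_basis f e i
  -- Summing over `j` first, the unit rows reduce the double series to `∑ |b i - a i - 1|`.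
  have hdev : Summable fun p : ℕ × ℕ => c p.1 p.2 ^ 2 * |b p.1 - a p.1 - 1| := by
    rw [summable_prod_of_nonneg fun p => by positivity]
    refine ⟨fun i => (hrow i).summable.mul_right |b i - a i - 1|, ?_⟩
    refine h.summable.congr fun i => ?_
    change _ = ∑' j, c i j ^ 2 * |b i - a i - 1|
    rw [tsum_mul_right, (hrow i).tsum_eq, one_mul]
  have hdev' : Summable fun p : ℕ × ℕ => c p.2 p.1 ^ 2 * |b p.2 - a p.2 - 1| :=
    hdev.prod_symm
  have hr : Summable fun j => max 0 (β j - α j - 1) + ∑' i, c i j ^ 2 * |b i - a i - 1| :=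
    hs.add hdev'.prod
  have hbound : ∀ (j : ℕ) (T : Finset ℕ), ∑ i ∈ T, D * (c i j * (1 - c i j))
      ≤ max 0 (β j - α j - 1) + ∑' i, c i j ^ 2 * |b i - a i - 1| := by
    intro j T
    have hw : Summable fun i => c i j * (b i - a i) :=
      summable_of_sum_le (fun i => mul_nonneg (hc0 i j) (sub_nonneg.2 (h.lt i).le))
        (hwidth j)
    have hw' : ∑' i, c i j * (b i - a i) ≤ β j - α j :=
      hw.tsum_le_of_sum_le (hwidth j)
    have hd := hdev'.prod_factor j
    have hsum := ((hw.hasSum.sub (hcol j)).add hd.hasSum)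
    -- With `d = b i - a i`, one has `c d - c² = d c (1 - c) + c² (d - 1)`. Summed over `i`, the
    -- left side is the width minus `1`, hence at most `β j - α j - 1`.
    have h1 : ∀ i, D * (c i j * (1 - c i j))
        ≤ c i j * (b i - a i) - c i j ^ 2 + c i j ^ 2 * |b i - a i - 1| := by
      intro i
      have e1 : 0 ≤ c i j * (1 - c i j) := mul_nonneg (hc0 i j) (by linarith [hc1 i j])
      have e2 := mul_le_mul_of_nonneg_right (hDd i) e1
      have e3 := mul_le_mul_of_nonneg_left (neg_abs_le (b i - a i - 1)) (sq_nonneg (c i j))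
      nlinarith
    have h2 := sum_le_hasSum T (fun i _ => (mul_nonneg hD.le
      (mul_nonneg (hc0 i j) (by linarith [hc1 i j]))).trans (h1 i)) hsum
    have h3 := Finset.sum_le_sum fun i (_ : i ∈ T) => h1 i
    have h4 := le_max_right 0 (β j - α j - 1)
    dsimp only at h2
    linarith
  have hnn : ∀ i j, 0 ≤ D * (c i j * (1 - c i j)) := fun i j =>
    mul_nonneg hD.le (mul_nonneg (hc0 i j) (by linarith [hc1 i j]))
  have hsw : Summable fun p : ℕ × ℕ => D * (c p.2 p.1 * (1 - c p.2 p.1)) := by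
    rw [summable_prod_of_nonneg fun p => hnn p.2 p.1]
    have hS : ∀ j, Summable fun i => D * (c i j * (1 - c i j)) := fun j =>
      summable_of_sum_le (fun i => hnn i j) (hbound j)
    exact ⟨hS, Summable.of_nonneg_of_le (fun j => tsum_nonneg fun i => hnn i j)
      (fun j => (hS j).tsum_le_of_sum_le (hbound j)) hr⟩
  have hT := (summable_mul_left_iff hD.ne').1 hsw
  simp only [hc] at hT
  exact Summable.prod_symm hT

/-! ### Avoiding a rectangle of the other basis -/

/-- Eventually the positive part `t` of the logarithm is at most `1`, and there `exp t - 1 ≤ 2 * t`.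
-/
theorem summable_max_sub_one {d : ℕ → ℝ} (hd : ∀ j, 0 < d j)
    (hs : Summable fun j => max 0 (Real.log (d j))) : Summable fun j => max 0 (d j - 1) := by
  refine Summable.of_norm_bounded_eventually_nat (hs.mul_left 2) ?_
  filter_upwards [hs.tendsto_atTop_zero.eventually_le_const one_pos] with j hj
  have h0 : max 0 (d j - 1) ≤ |Real.exp (max 0 (Real.log (d j))) - 1| := by
    refine max_le (abs_nonneg _) (le_trans ?_ (le_abs_self _))
    have := Real.exp_le_exp.2 (le_max_right 0 (Real.log (d j)))
    rw [Real.exp_log (hd j)] at this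
    linarith
  have h1 := Real.abs_exp_sub_one_le (x := max 0 (Real.log (d j)))
    (by rwa [abs_of_nonneg (le_max_left _ _)])
  rw [abs_of_nonneg (le_max_left 0 (Real.log (d j)))] at h1
  rw [Real.norm_of_nonneg (le_max_left _ _)]
  exact h0.trans h1

/-- Changing finitely many edges keeps the volume positive, and because the columns of the matrix
are in `ℓ¹` this suffices to make the oscillation of `⟪·, f j⟫` about a chosen point as small as
desired. -/
theorem exists_posRect_disjoint {e f : HilbertBasis ℕ ℝ E} (hef : ¬ IsSummablyNear e f)
    (hcol : ∀ j, Summable fun i => |inner ℝ (e i) (f j)|) {a b : ℕ → ℝ} (h : IsPosRect e a b)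
    {Q : Set E} (hQ : Q ∈ rectangles f) :
    ∃ a' b', IsPosRect e a' b' ∧ rect e a' b' ⊆ rect e a b ∧ Disjoint (rect e a' b') Q := by
  obtain ⟨α, β, hαβ, rfl⟩ := hQ
  rcases Set.eq_empty_or_nonempty (rect f α β) with h0 | h0
  · exact ⟨a, b, h, le_rfl, by rw [h0]; exact Set.disjoint_empty _⟩
  have hlt : ∀ j, α j < β j := fun j => by
    obtain ⟨z, hz⟩ := h0
    exact (hz j).1.trans_lt (hz j).2
  have hs := summable_max_sub_one (fun j => sub_pos.2 (hlt j))
    (hαβ.empty_or_summable.resolve_left h0.ne_empty)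
  -- The margins are summable, so the enlarged rectangle still meets the hypothesis of
  -- `isSummablyNear_of_subset`; some `x` must then miss it in a direction `f j`.
  let ε : ℕ → ℝ := fun j => (1 / 2) ^ j
  have hε : ∀ j, 0 < ε j := fun j => by positivity
  obtain ⟨x, hx, j, hj⟩ : ∃ x ∈ rect e a b, ∃ j,
      inner ℝ x (f j) ∉ Set.Icc (α j - ε j) (β j + ε j) := by
    by_contra! hcon
    refine hef (isSummablyNear_of_subset h ?_ hcon)
    refine Summable.of_nonneg_of_le (fun j => le_max_left _ _) (fun j => ?_)
      (hs.add (summable_geometric_two.mul_left 2))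
    have h1 := le_max_left 0 (β j - α j - 1)
    have h2 := le_max_right 0 (β j - α j - 1)
    have h3 := hε j
    simp only [ε] at h3 ⊢
    exact max_le (by linarith) (by linarith)
  -- One `N` controls both the tail, where edges are kept, and the head, where they shrink to at
  -- most `1 / (N + 1)`. Each term tends to `0`, and dominated convergence gives the sum.
  obtain ⟨N, hN⟩ : ∃ N : ℕ, ∑' i, |inner ℝ (e i) (f j)| *
      (if i < N then 1 / ((N : ℝ) + 1) else b i - a i) < ε j := by
    have hd : ∀ i, 0 < b i - a i := fun i => sub_pos.2 (h.lt i)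
    obtain ⟨M, hM⟩ : ∃ M, ∀ i, |b i - a i - 1| ≤ M := by
      obtain ⟨M, hM⟩ := h.summable.tendsto_atTop_zero.bddAbove_range
      exact ⟨M, fun i => hM ⟨i, rfl⟩⟩
    have key : Tendsto (fun N : ℕ => ∑' i, |inner ℝ (e i) (f j)| *
        (if i < N then 1 / ((N : ℝ) + 1) else b i - a i)) atTop (𝓝 (∑' _ : ℕ, (0 : ℝ))) := by
      refine tendsto_tsum_of_dominated_convergence ((hcol j).mul_right (M + 1)) (fun i => ?_)
        (Eventually.of_forall fun N i => ?_)
      · have : Tendsto (fun N : ℕ => |inner ℝ (e i) (f j)| * (1 / ((N : ℝ) + 1))) atTop (𝓝 0) := by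
          simpa using tendsto_one_div_add_atTop_nhds_zero_nat.const_mul |inner ℝ (e i) (f j)|
        refine this.congr' ?_
        filter_upwards [eventually_gt_atTop i] with N hN
        rw [if_pos hN]
      · have h1 := (abs_nonneg _).trans (hM i)
        have h2 := (le_abs_self _).trans (hM i)
        have h4 : 1 / ((N : ℝ) + 1) ≤ 1 := by
          rw [div_le_one (by positivity)]
          linarith [N.cast_nonneg (α := ℝ)]
        have h5 : 0 < 1 / ((N : ℝ) + 1) := by positivity
        rw [norm_mul, Real.norm_eq_abs, abs_abs]
        refine mul_le_mul_of_nonneg_left ?_ (abs_nonneg _)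
        rw [Real.norm_eq_abs]
        split_ifs
        · rw [abs_of_pos h5]; linarith
        · rw [abs_of_pos (hd i)]; linarith
    rw [tsum_zero] at key
    exact (key.eventually_lt_const (hε j)).exists
  set η : ℝ := 1 / ((N : ℝ) + 1) with hη
  have hη0 : 0 < η := by positivity
  -- In the first `N` directions `x` becomes the lower endpoint, which the half-open edge contains.
  let a' : ℕ → ℝ := fun i => if i < N then inner ℝ x (e i) else a i
  let b' : ℕ → ℝ := fun i => if i < N then min (b i) (inner ℝ x (e i) + η) else b i
  have hsub : rect e a' b' ⊆ rect e a b := by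
    intro y hy i
    have h1 := hy i
    have h2 := hx i
    simp only [a', b'] at h1
    split_ifs at h1
    · exact ⟨h2.1.trans h1.1, h1.2.trans_le (min_le_left _ _)⟩
    · exact h1
  have hxm : x ∈ rect e a' b' := by
    intro i
    have h2 := hx i
    simp only [a', b']
    split_ifs
    · exact ⟨le_rfl, lt_min h2.2 (by linarith)⟩
    · exact h2
  refine ⟨a', b', ⟨fun i => (hxm i).1.trans_lt (hxm i).2, ?_, x, hxm⟩, hsub, ?_⟩
  · refine h.summable.congr_cofinite ?_
    rw [Nat.cofinite_eq_atTop]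
    filter_upwards [eventually_ge_atTop N] with i hi
    simp only [a', b', if_neg (not_lt.2 hi)]
  · rw [Set.disjoint_left]
    intro y hy hyQ
    apply hj
    have hterm : ∀ i, |inner ℝ (y - x) (e i) * inner ℝ (e i) (f j)|
        ≤ |inner ℝ (e i) (f j)| * (if i < N then η else b i - a i) := by
      intro i
      rw [abs_mul, mul_comm]
      refine mul_le_mul_of_nonneg_left ?_ (abs_nonneg _)
      rw [inner_sub_left]
      have h1 := hy i
      have h2 := hx i
      simp only [a', b'] at h1
      split_ifs at h1 ⊢
      · have := h1.2.trans_le (min_le_right _ _)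
        rw [abs_le]; constructor <;> linarith [h1.1]
      · rw [abs_le]; constructor <;> linarith [h1.1, h1.2, h2.1, h2.2]
    have hsm : Summable fun i => |inner ℝ (e i) (f j)| * (if i < N then η else b i - a i) := by
      have hdev : Summable fun i => |inner ℝ (e i) (f j)| * (b i - a i - 1) :=
        Summable.of_norm_bounded h.summable fun i => by
          rw [norm_mul, Real.norm_eq_abs, abs_abs]
          exact mul_le_of_le_one_left (abs_nonneg _) (abs_inner_basis_le_one e f i j)
      refine (((hcol j).add hdev).congr fun i => (by ring :
        _ = |inner ℝ (e i) (f j)| * (b i - a i))).congr_cofinite ?_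
      rw [Nat.cofinite_eq_atTop]
      filter_upwards [eventually_ge_atTop N] with i hi
      rw [if_neg (not_lt.2 hi)]
    have hHS := e.hasSum_inner_mul_inner (y - x) (f j)
    have hle : |inner ℝ (y - x) (f j)| < ε j := by
      rw [← hHS.tsum_eq]
      exact (tsum_of_norm_bounded (f := fun i => inner ℝ (y - x) (e i) * inner ℝ (e i) (f j))
        hsm.hasSum hterm).trans_lt hN
    rw [inner_sub_left, abs_lt] at hle
    have h1 := hyQ j
    constructor <;> linarith [h1.1, h1.2, hle.1, hle.2]

/-- A rectangle of positive volume along `e` has no finite cover by rectangles along `f`. -/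
theorem not_subset_sUnion {e f : HilbertBasis ℕ ℝ E} (hef : ¬ IsSummablyNear e f) {t : Set (Set E)}
    (ht : t.Finite) (htf : t ⊆ rectangles f) {a b : ℕ → ℝ} (h : IsPosRect e a b) :
    ¬ rect e a b ⊆ ⋃₀ t := by
  intro hsub
  -- A finite union of `f`-rectangles is bounded in each direction `f j`, hence so is the covered
  -- rectangle.
  have hcol : ∀ j, Summable fun i => |inner ℝ (e i) (f j)| := by
    intro j
    have hbd : Bornology.IsBounded ((fun x => inner ℝ x (f j)) '' ⋃₀ t) := by
      rw [Set.sUnion_eq_biUnion, Set.image_iUnion₂, Bornology.isBounded_biUnion ht]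
      intro Q hQ
      obtain ⟨α, β, -, rfl⟩ := htf hQ
      refine (Metric.isBounded_Ico (α j) (β j)).subset ?_
      rintro _ ⟨x, hx, rfl⟩
      exact hx j
    obtain ⟨R, hR⟩ := hbd.subset_closedBall 0
    rw [Real.closedBall_eq_Icc] at hR
    exact summable_abs_inner_of_bounded h fun x hx => hR ⟨x, hsub hx, rfl⟩
  have key : ∃ a' b', IsPosRect e a' b' ∧ rect e a' b' ⊆ rect e a b ∧
      ∀ Q ∈ t, Disjoint (rect e a' b') Q := by
    -- The cover has served to bound the columns. The induction runs over subfamilies of `t`, which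
    -- need not cover.
    clear hsub
    induction t, ht using Set.Finite.induction_on with
    | empty => exact ⟨a, b, h, le_rfl, by simp⟩
    | @insert Q t _ _ ih =>
      obtain ⟨a₁, b₁, h₁, hs₁, hd₁⟩ := ih ((Set.subset_insert _ _).trans htf)
      obtain ⟨a₂, b₂, h₂, hs₂, hd₂⟩ :=
        exists_posRect_disjoint hef hcol h₁ (htf (Set.mem_insert _ _))
      refine ⟨a₂, b₂, h₂, hs₂.trans hs₁, ?_⟩
      rintro R (rfl | hR)
      exacts [hd₂, (hd₁ R hR).mono_left hs₂]
  obtain ⟨a', b', h', hs', hd'⟩ := key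
  obtain ⟨x, hx⟩ := h'.nonempty
  obtain ⟨Q, hQ, hxQ⟩ := hsub (hs' hx)
  exact Set.disjoint_left.1 (hd' Q hQ) hx hxQ

/-- Sets with such a cover form a ring: a difference inherits the cover of its first term. -/
theorem exists_finite_cover {f : HilbertBasis ℕ ℝ E} {C : Set E} (hC : C ∈ rectRing f) :
    ∃ t : Set (Set E), t.Finite ∧ t ⊆ rectangles f ∧ C ⊆ ⋃₀ t := by
  refine hC {C | ∃ t : Set (Set E), t.Finite ∧ t ⊆ rectangles f ∧ C ⊆ ⋃₀ t} ⟨⟨?_, ?_, ?_⟩, ?_⟩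
  · exact ⟨∅, Set.finite_empty, Set.empty_subset _, Set.empty_subset _⟩
  · rintro A B ⟨s, hs, hsf, hA⟩ ⟨t, ht, htf, hB⟩
    exact ⟨s ∪ t, hs.union ht, Set.union_subset hsf htf, by
      rw [Set.sUnion_union]; exact Set.union_subset_union hA hB⟩
  · rintro A B ⟨s, hs, hsf, hA⟩ -
    exact ⟨s, hs, hsf, Set.sdiff_subset.trans hA⟩
  · intro Q hQ
    exact ⟨{Q}, Set.finite_singleton _, Set.singleton_subset_iff.2 hQ, by simp⟩

/-! ### Sets of positive measure contain rectangles of positive volume -/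

/-- The boxes of finite measure with summable excess of the edges over `1`. -/
def smallBoxes : Set (Set (ℕ → ℝ)) :=
  {B | B ∈ seqRing ∧ ∃ a b, (Summable fun j => max 0 (b j - a j - 1)) ∧ B = seqBox a b}

/-- The countable unions of such boxes. -/
def smallBoxUnions : Set (Set (ℕ → ℝ)) :=
  {S | ∃ t : Set (Set (ℕ → ℝ)), t.Countable ∧ t ⊆ smallBoxes ∧ ⋃₀ t = S}

theorem iUnion_mem_smallBoxUnions {ι : Type*} [Countable ι] {S : ι → Set (ℕ → ℝ)}
    (h : ∀ i, S i ∈ smallBoxUnions) : ⋃ i, S i ∈ smallBoxUnions := by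
  choose t ht hts hS using h
  exact ⟨⋃ i, t i, Set.countable_iUnion ht, Set.iUnion_subset hts, by
    rw [Set.sUnion_iUnion]; exact Set.iUnion_congr hS⟩

theorem smallBoxes_subset_unions : smallBoxes ⊆ smallBoxUnions := fun B hB =>
  ⟨{B}, Set.countable_singleton _, Set.singleton_subset_iff.2 hB, Set.sUnion_singleton _⟩

theorem union_mem_smallBoxUnions {S T : Set (ℕ → ℝ)} (hS : S ∈ smallBoxUnions)
    (hT : T ∈ smallBoxUnions) : S ∪ T ∈ smallBoxUnions := by
  rw [Set.union_eq_iUnion]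
  exact iUnion_mem_smallBoxUnions (by rintro (_ | _) <;> assumption)

/-- An operation that commutes with unions can be checked on boxes. -/
theorem smallBoxUnions_of_boxes {g : Set (ℕ → ℝ) → Set (ℕ → ℝ)}
    (hg : ∀ t : Set (Set (ℕ → ℝ)), g (⋃₀ t) = ⋃ B : t, g B)
    (h : ∀ B ∈ smallBoxes, g B ∈ smallBoxUnions) {S : Set (ℕ → ℝ)} (hS : S ∈ smallBoxUnions) :
    g S ∈ smallBoxUnions := by
  obtain ⟨t, ht, hts, rfl⟩ := hS
  rw [hg]
  have := ht.to_subtype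
  exact iUnion_mem_smallBoxUnions fun B => h B (hts B.2)

theorem inter_mem_smallBoxes {S T : Set (ℕ → ℝ)} (hS : S ∈ smallBoxes) (hT : T ∈ smallBoxes) :
    S ∩ T ∈ smallBoxes := by
  refine ⟨isSetRing_seqRing.inter_mem hS.1 hT.1, ?_⟩
  obtain ⟨-, a, b, hs, rfl⟩ := hS
  obtain ⟨-, a', b', -, rfl⟩ := hT
  refine ⟨fun j => max (a j) (a' j), fun j => min (b j) (b' j), ?_, ?_⟩
  · refine Summable.of_nonneg_of_le (fun j => le_max_left _ _) (fun j => max_le_max le_rfl ?_) hs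
    linarith [le_max_left (a j) (a' j), min_le_left (b j) (b' j)]
  · simp only [seqBox, ← Set.pi_inter_distrib, Set.Ico_inter_Ico]

theorem inter_mem_smallBoxUnions {S T : Set (ℕ → ℝ)} (hS : S ∈ smallBoxUnions)
    (hT : T ∈ smallBoxUnions) : S ∩ T ∈ smallBoxUnions := by
  refine smallBoxUnions_of_boxes (g := fun B => B ∩ T) (fun t => ?_) (fun B hB => ?_) hS
  · simp only [Set.sUnion_eq_iUnion, Set.iUnion_inter]
  refine smallBoxUnions_of_boxes (g := fun C => B ∩ C) (fun t => ?_) (fun C hC => ?_) hT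
  · simp only [Set.sUnion_eq_iUnion, Set.inter_iUnion]
  exact smallBoxes_subset_unions (inter_mem_smallBoxes hB hC)

theorem inter_coord_mem_seqRing {S : Set (ℕ → ℝ)} (hS : S ∈ seqRing) (j : ℕ) {I : Set ℝ}
    (hI : MeasurableSet I) : S ∩ {x | x j ∈ I} ∈ seqRing := by
  obtain ⟨⟨s, hs0, hs, hst⟩, hm, hf⟩ := hS
  refine ⟨⟨s, hs0, hs, fun x t hx => ?_⟩, hm.inter (measurable_pi_apply j hI),
    measure_ne_top_of_subset Set.inter_subset_left hf⟩
  filter_upwards [hst x t hx, eventually_gt_atTop j] with M hM hj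
  have : truncTail x t M j = x j := if_pos hj
  simp only [Set.mem_inter_iff, Set.mem_ofPred_eq, hM, this]

/-- A point outside a box violates one of countably many one-coordinate inequalities, and cutting a
box by such an inequality never lengthens its edges. This is why countable unions are needed. -/
theorem sdiff_seqBox_mem_smallBoxUnions {S : Set (ℕ → ℝ)} (hS : S ∈ smallBoxes) (a' b' : ℕ → ℝ) :
    S \ seqBox a' b' ∈ smallBoxUnions := by
  have hcover : S \ seqBox a' b'
      = ⋃ j, (S ∩ {x | x j ∈ Set.Iio (a' j)}) ∪ (S ∩ {x | x j ∈ Set.Ici (b' j)}) := by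
    ext x
    simp only [seqBox, Set.mem_sdiff, Set.mem_univ_pi, Set.mem_iUnion, Set.mem_union,
      Set.mem_inter_iff, Set.mem_ofPred_eq, Set.mem_Ico, Set.mem_Iio, Set.mem_Ici, not_forall,
      ← and_or_left, exists_and_left, not_and_or, not_le, not_lt]
  have hr := hS.1
  rw [hcover]
  obtain ⟨-, a, b, hs, rfl⟩ := hS
  refine iUnion_mem_smallBoxUnions fun j => union_mem_smallBoxUnions
    (smallBoxes_subset_unions ⟨inter_coord_mem_seqRing hr j measurableSet_Iio, a,
      Function.update b j (min (b j) (a' j)), ?_, ?_⟩)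
    (smallBoxes_subset_unions ⟨inter_coord_mem_seqRing hr j measurableSet_Ici,
      Function.update a j (max (a j) (b' j)), b, ?_, ?_⟩)
  · refine Summable.of_nonneg_of_le (fun i => le_max_left _ _) (fun i => max_le_max le_rfl ?_) hs
    rcases eq_or_ne i j with rfl | hi
    · rw [Function.update_self]; linarith [min_le_left (b i) (a' i)]
    · rw [Function.update_of_ne hi]
  · ext x
    simp only [seqBox, Set.mem_inter_iff, Set.mem_univ_pi, Set.mem_ofPred_eq, Set.mem_Ico,
      Set.mem_Iio]
    refine ⟨fun ⟨h1, h2⟩ i => ?_, fun h => ⟨fun i => ?_, ?_⟩⟩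
    · rcases eq_or_ne i j with rfl | hi
      · rw [Function.update_self]; exact ⟨(h1 i).1, lt_min (h1 i).2 h2⟩
      · rw [Function.update_of_ne hi]; exact h1 i
    · have := h i
      rcases eq_or_ne i j with rfl | hi
      · rw [Function.update_self] at this; exact ⟨this.1, (lt_min_iff.1 this.2).1⟩
      · rwa [Function.update_of_ne hi] at this
    · have := h j
      rw [Function.update_self] at this; exact (lt_min_iff.1 this.2).2
  · refine Summable.of_nonneg_of_le (fun i => le_max_left _ _) (fun i => max_le_max le_rfl ?_) hs
    rcases eq_or_ne i j with rfl | hi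
    · rw [Function.update_self]; linarith [le_max_left (a i) (b' i)]
    · rw [Function.update_of_ne hi]
  · ext x
    simp only [seqBox, Set.mem_inter_iff, Set.mem_univ_pi, Set.mem_ofPred_eq, Set.mem_Ico,
      Set.mem_Ici]
    refine ⟨fun ⟨h1, h2⟩ i => ?_, fun h => ⟨fun i => ?_, ?_⟩⟩
    · rcases eq_or_ne i j with rfl | hi
      · rw [Function.update_self]; exact ⟨max_le (h1 i).1 h2, (h1 i).2⟩
      · rw [Function.update_of_ne hi]; exact h1 i
    · have := h i
      rcases eq_or_ne i j with rfl | hi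
      · rw [Function.update_self] at this; exact ⟨(max_le_iff.1 this.1).1, this.2⟩
      · rwa [Function.update_of_ne hi] at this
    · have := h j
      rw [Function.update_self] at this; exact (max_le_iff.1 this.1).2

theorem exists_seqRing_mem_smallBoxUnions (e : HilbertBasis ℕ ℝ E) {A : Set E}
    (hA : A ∈ rectRing e) : ∃ S ∈ seqRing, S ∈ smallBoxUnions ∧ coords e ⁻¹' S = A := by
  -- Countable unions of boxes are not evidently closed under differences; the extra clause on `B \
  -- S` carries the induction through the ring operations.
  suffices h : ∃ S ∈ seqRing, (S ∈ smallBoxUnions ∧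
      ∀ B ∈ smallBoxUnions, B \ S ∈ smallBoxUnions) ∧ coords e ⁻¹' S = A by
    obtain ⟨S, h1, h2, h3⟩ := h
    exact ⟨S, h1, h2.1, h3⟩
  have hempty : (∅ : Set (ℕ → ℝ)) ∈ smallBoxUnions :=
    ⟨∅, Set.countable_empty, Set.empty_subset _, Set.sUnion_empty⟩
  have h0 : ∃ S ∈ seqRing, (S ∈ smallBoxUnions ∧
      ∀ B ∈ smallBoxUnions, B \ S ∈ smallBoxUnions) ∧ coords e ⁻¹' S = (∅ : Set E) :=
    ⟨∅, isSetRing_seqRing.empty_mem, ⟨hempty, fun B hB => by rwa [Set.sdiff_empty]⟩, rfl⟩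
  refine hA {A | ∃ S ∈ seqRing, (S ∈ smallBoxUnions ∧
    ∀ B ∈ smallBoxUnions, B \ S ∈ smallBoxUnions) ∧ coords e ⁻¹' S = A} ⟨⟨h0, ?_, ?_⟩, ?_⟩
  · rintro _ _ ⟨S, hS, ⟨hS1, hS2⟩, rfl⟩ ⟨T, hT, ⟨hT1, hT2⟩, rfl⟩
    refine ⟨_, isSetRing_seqRing.union_mem hS hT,
      ⟨union_mem_smallBoxUnions hS1 hT1, fun B hB => ?_⟩, rfl⟩
    rw [← Set.sdiff_sdiff]
    exact hT2 _ (hS2 _ hB)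
  · rintro _ _ ⟨S, hS, ⟨hS1, hS2⟩, rfl⟩ ⟨T, hT, ⟨hT1, hT2⟩, rfl⟩
    refine ⟨_, isSetRing_seqRing.sdiff_mem hS hT, ⟨hT2 _ hS1, fun B hB => ?_⟩, rfl⟩
    have : B \ (S \ T) = (B \ S) ∪ (B ∩ T) := by
      ext x; simp only [Set.mem_sdiff, Set.mem_union, Set.mem_inter_iff]; tauto
    rw [this]
    exact union_mem_smallBoxUnions (hS2 _ hB) (inter_mem_smallBoxUnions hB hT1)
  · rintro _ ⟨a, b, h, rfl⟩
    rcases Set.eq_empty_or_nonempty (rect e a b) with hne | hne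
    · rwa [hne]
    have hab : ∀ j, a j < b j := fun j => by
      obtain ⟨z, hz⟩ := hne
      exact (hz j).1.trans_lt (hz j).2
    have hr := (seqBox_mem_seqRing h hne).1
    refine ⟨_, hr, ⟨smallBoxes_subset_unions ⟨hr, a, b, summable_max_sub_one
      (fun j => sub_pos.2 (hab j)) (h.empty_or_summable.resolve_left hne.ne_empty), rfl⟩,
      fun B hB => ?_⟩, ?_⟩
    · refine smallBoxUnions_of_boxes (g := fun B => B \ seqBox a b) (fun t => ?_)
        (fun B hB => sdiff_seqBox_mem_smallBoxUnions hB a b) hB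
      simp only [Set.sUnion_eq_iUnion, Set.iUnion_sdiff]
    · ext x
      simp [seqBox, rect, coords]

/-- The ring measure is the restriction of the measure on sequences. -/
theorem ringMeasure_preimage (e : HilbertBasis ℕ ℝ E) {S : Set (ℕ → ℝ)} (hS : S ∈ seqRing)
    (hSe : coords e ⁻¹' S ∈ rectRing e) :
    ringMeasure e (coords e ⁻¹' S) = (seqMeasure S).toReal := by
  classical
  -- `ringMeasure` is an unspecified choice of extension, so this explicit one is built and
  -- identified with it by uniqueness.
  let m : Set E → ℝ := fun A =>
    if h : ∃ S ∈ seqRing, coords e ⁻¹' S = A then (seqMeasure h.choose).toReal else 0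
  have hm : ∀ S ∈ seqRing, m (coords e ⁻¹' S) = (seqMeasure S).toReal := by
    intro S hS
    have h : ∃ T ∈ seqRing, coords e ⁻¹' T = coords e ⁻¹' S := ⟨S, hS, rfl⟩
    simp only [m, dif_pos h]
    rw [eq_of_preimage e h.choose_spec.1 hS h.choose_spec.2]
  rw [← hm S hS]
  refine (isRectExtension_ringMeasure e).unique
    ⟨fun A hA => ?_, fun A hA B hB hd => ?_, fun a b h h0 => ?_⟩ _ hSe
  · obtain ⟨S, hS, rfl⟩ := exists_seqRing e hA
    rw [hm S hS]; exact ENNReal.toReal_nonneg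
  · obtain ⟨S, hS, rfl⟩ := exists_seqRing e hA
    obtain ⟨T, hT, rfl⟩ := exists_seqRing e hB
    have hST : Disjoint S T := by
      rw [Set.disjoint_iff_inter_eq_empty] at hd ⊢
      exact eq_empty_of_preimage e (isSetRing_seqRing.inter_mem hS hT) hd
    rw [← Set.preimage_union, hm _ (isSetRing_seqRing.union_mem hS hT), hm S hS, hm T hT,
      measure_union hST hT.2.1, ENNReal.toReal_add hS.2.2 hT.2.2]
  · obtain ⟨h1, h2⟩ := seqBox_mem_seqRing h h0
    have h3 : rect e a b = coords e ⁻¹' seqBox a b := by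
      ext x
      simp [seqBox, rect, coords]
    rw [h3, hm _ h1, h2, ENNReal.toReal_ofReal (rectVolume_nonneg a b)]

theorem summable_abs_sub_one {d : ℕ → ℝ} (hd : ∀ j, 0 < d j)
    (hs : Summable fun j => Real.log (d j)) : Summable fun j => |d j - 1| := by
  refine Summable.of_norm_bounded_eventually_nat (hs.abs.mul_left 2) ?_
  filter_upwards [hs.abs.tendsto_atTop_zero.eventually_le_const one_pos] with j hj
  have := Real.abs_exp_sub_one_le hj
  rw [Real.exp_log (hd j)] at this
  rwa [Real.norm_eq_abs, abs_abs]

/-- A divergent series of logarithms would give `rectVolume` its value `0`. Nonemptiness in `E`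
holds because a set of `seqRing` with empty trace on `E` is empty. -/
theorem isPosRect_of_seqMeasure_pos (e : HilbertBasis ℕ ℝ E) {a b : ℕ → ℝ}
    (hr : seqBox a b ∈ seqRing) (hs : Summable fun j => max 0 (b j - a j - 1))
    (hpos : seqMeasure (seqBox a b) ≠ 0) : IsPosRect e a b := by
  have hpre : rect e a b = coords e ⁻¹' seqBox a b := by
    ext x
    simp [seqBox, rect, coords]
  have hne : (rect e a b).Nonempty := by
    rw [Set.nonempty_iff_ne_empty, hpre]
    intro h
    rw [eq_empty_of_preimage e hr h, measure_empty] at hpos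
    exact hpos rfl
  have hab : ∀ j, a j < b j := fun j => by
    obtain ⟨z, hz⟩ := hne
    exact (hz j).1.trans_lt (hz j).2
  have hlog : Summable fun j => max 0 (Real.log (b j - a j)) :=
    Summable.of_nonneg_of_le (fun j => le_max_left _ _) (fun j => max_le_max le_rfl
      (Real.log_le_sub_one_of_pos (sub_pos.2 (hab j)))) hs
  refine ⟨hab, summable_abs_sub_one (fun j => sub_pos.2 (hab j)) ?_, hne⟩
  by_contra hcon
  rw [seqMeasure_seqBox hab, boxVol_eq_rectVolume hab hlog, rectVolume, if_neg hcon] at hpos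
  simp at hpos

/-- If every box of a countable union were null, so would be the union. -/
theorem exists_posRect_subset {e : HilbertBasis ℕ ℝ E} {B : Set E} (hB : B ∈ rectRing e)
    (hpos : 0 < ringMeasure e B) : ∃ a b, IsPosRect e a b ∧ rect e a b ⊆ B := by
  obtain ⟨S, hS, ⟨t, htc, hts, rfl⟩, rfl⟩ := exists_seqRing_mem_smallBoxUnions e hB
  rw [ringMeasure_preimage e hS hB] at hpos
  have hne : seqMeasure (⋃₀ t) ≠ 0 := fun h => by simp [h] at hpos
  rw [ne_eq, measure_sUnion_null_iff htc] at hne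
  push Not at hne
  obtain ⟨C, hC, hC0⟩ := hne
  obtain ⟨hr, a, b, hs, rfl⟩ := hts hC
  exact ⟨a, b, isPosRect_of_seqMeasure_pos e hr hs hC0, fun x hx =>
    ⟨_, hC, fun j _ => hx j⟩⟩

/-! ### Comparison of the measures -/

theorem not_subset_of_ringMeasure_pos {e f : HilbertBasis ℕ ℝ E} (hef : ¬ IsSummablyNear e f)
    {B C : Set E} (hB : B ∈ rectRing e) (hpos : 0 < ringMeasure e B) (hC : C ∈ rectRing f) :
    ¬ B ⊆ C := by
  intro hBC
  obtain ⟨a, b, hab, hsub⟩ := exists_posRect_subset hB hpos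
  obtain ⟨t, ht, htf, hCt⟩ := exists_finite_cover hC
  exact not_subset_sUnion hef ht htf hab ((hsub.trans hBC).trans hCt)

theorem measure_nonneg (e : HilbertBasis ℕ ℝ E) (A : Set E) : 0 ≤ measure e A := by
  refine Real.sInf_nonneg ?_
  rintro _ ⟨C, hC, rfl⟩
  exact (isRectExtension_ringMeasure e).nonneg C hC.1

theorem measure_le_ringMeasure {e : HilbertBasis ℕ ℝ E} {A C : Set E} (hC : C ∈ rectRing e)
    (hAC : A ⊆ C) : measure e A ≤ ringMeasure e C := by
  refine csInf_le ⟨0, ?_⟩ ⟨C, ⟨hC, hAC⟩, rfl⟩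
  rintro _ ⟨C, hC, rfl⟩
  exact (isRectExtension_ringMeasure e).nonneg C hC.1

theorem measure_eq_zero_of_measurableRing {e f : HilbertBasis ℕ ℝ E} (hef : ¬ IsSummablyNear e f)
    {A : Set E} (hAe : A ∈ measurableRing e) (hAf : A ∈ measurableRing f) : measure e A = 0 := by
  by_contra hne
  have hpos := (measure_nonneg e A).lt_of_ne' hne
  -- With `ε` the measure of `A` itself, `C \ B` is smaller than `C`, so the inner set `B` has
  -- positive measure.
  obtain ⟨B, hB, C, hC, hBA, hAC, hlt⟩ := hAe _ hpos
  obtain ⟨_, _, D, hD, _, hAD, _⟩ := hAf 1 one_pos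
  have hadd := (isRectExtension_ringMeasure e).additive _
    ((isSetRing_rectRing e).sdiff_mem hC hB) B hB Set.disjoint_sdiff_left
  rw [Set.sdiff_union_of_subset (hBA.trans hAC)] at hadd
  have hle := measure_le_ringMeasure hC hAC
  exact not_subset_of_ringMeasure_pos hef hB (by linarith) hD (hBA.trans hAD)

/-- No set of the ring of `f` contains `P`, so the infimum runs over an empty family. -/
theorem outerMeasure_eq_top {e f : HilbertBasis ℕ ℝ E} (hef : ¬ IsSummablyNear e f)
    {P : Set E} (hP : P ∈ rectangles e) (hpos : 0 < measure e P) : outerMeasure f P = ⊤ := by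
  have hPr := rectangles_subset_rectRing e hP
  have hpos' := hpos.trans_le (measure_le_ringMeasure hPr le_rfl)
  refine iInf₂_eq_top.2 fun C hC => ?_
  exact absurd hC.2 (not_subset_of_ringMeasure_pos hef hPr hpos' hC.1)

end RectMeasure

theorem theorem5p1 {E : Type*} [NormedAddCommGroup E] [InnerProductSpace ℝ E] [CompleteSpace E]
    (e f : HilbertBasis ℕ ℝ E) (hef : ¬ RectMeasure.IsNear e f) :
    (∀ A ∈ RectMeasure.measurableRing e ∩ RectMeasure.measurableRing f,
      RectMeasure.measure e A = 0 ∧ RectMeasure.measure f A = 0) ∧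
    (∀ P ∈ RectMeasure.rectangles e, 0 < RectMeasure.measure e P →
      RectMeasure.outerMeasure f P = ⊤) ∧
    (∀ Q ∈ RectMeasure.rectangles f, 0 < RectMeasure.measure f Q →
      RectMeasure.outerMeasure e Q = ⊤) := by
  have h1 : ¬ RectMeasure.IsSummablyNear e f := fun h => hef h.isNear
  have h2 : ¬ RectMeasure.IsSummablyNear f e := fun h => h1 h.symm
  exact ⟨fun A hA => ⟨RectMeasure.measure_eq_zero_of_measurableRing h1 hA.1 hA.2,
    RectMeasure.measure_eq_zero_of_measurableRing h2 hA.2 hA.1⟩,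
    fun P hP hpos => RectMeasure.outerMeasure_eq_top h1 hP hpos,
    fun Q hQ hpos => RectMeasure.outerMeasure_eq_top h2 hQ hpos⟩
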